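/- Let $A$ be a $C^*$-algebra (not necessarily unital) and let $H$ be a Hilbert $A$-module: an $A$-module with an $A$-valued inner product $\langle\cdot,\cdot\rangle$, $\mathbb C$-linear and $A$-linear in the second variable, which is complete in the norm $\|x\|=\|\langle x,x\rangle\|^{1/2}$. For a submodule $M\subseteq H$ put $M^\perp=\{x\in H:\langle x,y\rangle=0 \text{ for all } y\in M\}$. A closed submodule $M$ is orthogonally complemented if $H$ is the direct sum of $M$ and $M^\perp$; in that case $P_M$ denotes the projection of $H$ onto $M$ along $M^\perp$. A projection on $H$ is an adjointable operator $P$ on $H$ with $P=P^2=P^*$; $\mathcal R(T)$ and $\mathcal N(T)$ denote the range and the null space of an operator $T$, and $\|T\|$ its operator norm. Two projections $P,Q$ on $H$ are called harmonious if the four closed submodules $$\overline{\mathcal R(P+Q)},\quad \overline{\mathcal R(P+I-Q)},\quad \overline{\mathcal R(I-P+Q)},\quad \overline{\mathcal R(I-P+I-Q)}$$ are all orthogonally complemented in $H$. If $P$ and $Q$ are harmonious projections on $H$, then $\mathcal R(P)\cap\mathcal R(Q)$ and $\mathcal N(P)\cap\mathcal N(Q)$ are orthogonally complemented in $H$, and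 $$\big\|PQ\big(I-P_{\mathcal R(P)\cap\mathcal R(Q)}\big)\big\|=\big\|(I-P)(I-Q)\big(I-P_{\mathcal N(P)\cap\mathcal N(Q)}\big)\big\|.$$ -/

import Mathlib

/-! In this file `H` is a Hilbert C⋆-module over a (not necessarily unital) C⋆-algebra `A`.
The `A`-valued inner product is Mathlib's `inner A x y`, linear in the second variable. -/

namespace HilbertModule

section Defs

variable (A : Type*) {H : Type*} [NonUnitalCStarAlgebra A] [PartialOrder A] [StarOrderedRing A]
  [SMul A H] [NormedAddCommGroup H] [NormedSpace ℂ H] [CStarModule A H]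

/-- `S` is the adjoint of `T` with respect to the `A`-valued inner product. -/
def IsAdjointOf (S T : H →L[ℂ] H) : Prop :=
  ∀ x y : H, inner A (T x) y = inner A x (S y)

/-- A projection is an adjointable operator `P` with `P = P² = P⋆`. -/
structure IsProjection (P : H →L[ℂ] H) : Prop where
  mul_self : P * P = P
  selfAdjoint : IsAdjointOf A P P

/-- The orthogonal complement `M^⊥ = {x | ⟨x, y⟩ = 0 for every y ∈ M}`. -/
def orthogonal (M : Submodule ℂ H) : Submodule ℂ H where
  carrier := {x | ∀ y ∈ M, inner A x y = 0}
  add_mem' := by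
    intro x x' hx hx' y hy
    simp [hx y hy, hx' y hy]
  zero_mem' := by
    intro y _
    simp
  smul_mem' := by
    intro c x hx y hy
    simp [hx y hy]

/-- `M` is orthogonally complemented: `H` is the direct sum of `M` and `M^⊥`. -/
abbrev OrthogonallyComplemented (M : Submodule ℂ H) : Prop :=
  IsCompl M (orthogonal A M)

variable {A}

/-- The map sending `m + n`, with `m ∈ M` and `n ∈ M^⊥`, to `m` is contractive. -/
theorem norm_projection_le {M : Submodule ℂ H} (hM : OrthogonallyComplemented A M) (x : H) :
    ‖M.projection (orthogonal A M) hM x‖ ≤ 1 * ‖x‖ := by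
  have hx := Submodule.projection_add_projection_eq_self hM x
  set m := M.projection (orthogonal A M) hM x with hm
  set n := (orthogonal A M).projection M (IsCompl.symm hM) x with hn
  have hmM : m ∈ M := (M.projectionOnto (orthogonal A M) hM x).2
  have hnM : n ∈ orthogonal A M :=
    ((orthogonal A M).projectionOnto M (IsCompl.symm hM) x).2
  have h1 : inner A n m = 0 := hnM m hmM
  have h2 : inner A m n = 0 := by
    rw [← CStarModule.star_inner n m, h1, star_zero]
  have h3 : inner A x x = inner A m m + inner A n n := by
    rw [← hx]
    simp [h1, h2]
  have h4 : ‖inner A m m‖ ≤ ‖inner A x x‖ := by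
    refine CStarAlgebra.norm_le_norm_of_nonneg_of_le CStarModule.inner_self_nonneg ?_
    rw [h3]
    exact le_add_of_nonneg_right CStarModule.inner_self_nonneg
  rw [one_mul, CStarModule.norm_eq_sqrt_norm_inner_self (A := A) m,
    CStarModule.norm_eq_sqrt_norm_inner_self (A := A) x]
  exact Real.sqrt_le_sqrt h4

/-- The projection `P_M` of `H` onto an orthogonally complemented `M`: it sends `m + n`, with
`m ∈ M` and `n ∈ M^⊥`, to `m`. -/
noncomputable def projectionOnto {M : Submodule ℂ H} (hM : OrthogonallyComplemented A M) :
    H →L[ℂ] H :=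
  LinearMap.mkContinuous (M.projection (orthogonal A M) hM) 1 (norm_projection_le hM)

variable (A)

/-- The range `R(T)`. -/
abbrev rangeOf (T : H →L[ℂ] H) : Submodule ℂ H := LinearMap.range (T : H →ₗ[ℂ] H)

/-- The null space `N(T)`. -/
abbrev nullOf (T : H →L[ℂ] H) : Submodule ℂ H := LinearMap.ker (T : H →ₗ[ℂ] H)

/-- Two projections `P`, `Q` are harmonious if the closures of the ranges of `P + Q`,
`P + (I - Q)`, `(I - P) + Q` and `(I - P) + (I - Q)` are all orthogonally complemented. -/
structure Harmonious (P Q : H →L[ℂ] H) : Prop where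
  isProjection_left : IsProjection A P
  isProjection_right : IsProjection A Q
  range_add : OrthogonallyComplemented A (rangeOf (P + Q)).topologicalClosure
  range_add_compl : OrthogonallyComplemented A (rangeOf (P + (1 - Q))).topologicalClosure
  range_compl_add : OrthogonallyComplemented A (rangeOf ((1 - P) + Q)).topologicalClosure
  range_compl_add_compl :
    OrthogonallyComplemented A (rangeOf ((1 - P) + (1 - Q))).topologicalClosure

end Defs

end HilbertModule

/-!
Write `X = P + Q - 1`, `Y = P - Q`, so that `X² + Y² = 1` and `XY = -YX`. The operator `X`
interchanges `P` with `Q`, the operator `Y` interchanges `P` with `1 - Q`, and therefore `Z = XY`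
interchanges `P` with `1 - P`. As `X²` commutes with `P`, `Q` and `Z`, and agrees with `PQP` on
`R(P)` and with `b = (1 - P)(1 - Q)(1 - P)` on `N(P)`, this gives `b Z = Z (PQP)`. Moreover `Z`
vanishes on `R(P) ∩ R(Q)`, so that `b Z = Z k` with `k = PQP (1 - E)`, where `E` is the projection
onto `R(P) ∩ R(Q)`. No continuous functional calculus is needed to compare norms: for `w = Z v`
one has `‖bⁿ w‖ = ‖Z kⁿ v‖ ≤ C ‖k‖ⁿ`, and since `n ↦ ‖bⁿ w‖` is log-convex for self-adjoint `b`,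
this forces `‖b w‖ ≤ ‖k‖ ‖w‖` (`IsAdjointOf.norm_apply_le_of_norm_pow_apply_le`).

In a Hilbert module an injective self-adjoint operator need not have dense range, and this is where
harmony enters. The vectors `w` with `‖bⁿ w‖ ≤ C ‖k‖ⁿ` form a subspace containing `R(Z)`, `R(P)`
and `N(P) ∩ R(Q)`. From the factorizations `Y² = (P + Q)(2 - P - Q)` and `X² = (1 + Y)(1 - Y)`,
and the splittings of `H` given by the closures of the ranges of `2 - P - Q`, `1 + Y` and `1 - Y`,
the closure of that subspace contains `R(P + Q)` (`Harmonious.add_apply_mem`). The closure of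
`R(P + Q)` is the orthogonal complement of `N(P) ∩ N(Q)`. Hence `‖b (1 - F)‖ ≤ ‖k‖`, with `F` the
projection onto `N(P) ∩ N(Q)`, and the
C⋆-identity turns this into one of the two inequalities
(`Harmonious.norm_compl_mul_compl_le`). The other one follows on replacing `P`, `Q` by `1 - P`,
`1 - Q`.
-/

namespace HilbertModule

/-! ### Identities for two idempotents -/

section Idempotents

variable {R : Type*} [Ring R] {p q : R}

/-- The product of `p + q - 1` and `p - q` carries the compression `pqp` to
`(1 - p)(1 - q)(1 - p)`. -/
theorem semiconjBy_compression (hp : p * p = p) (hq : q * q = q) :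
    SemiconjBy ((p + q - 1) * (p - q)) (p * q * p) ((1 - p) * (1 - q) * (1 - p)) := by
  have hp' : ∀ x, p * (p * x) = p * x := fun x => by rw [← mul_assoc, hp]
  have hq' : ∀ x, q * (q * x) = q * x := fun x => by rw [← mul_assoc, hq]
  unfold SemiconjBy
  simp only [mul_add, add_mul, mul_sub, sub_mul, mul_assoc, mul_one, one_mul, hp, hq, hp', hq']
  abel

theorem add_mul_compl_add_compl (hp : p * p = p) (hq : q * q = q) :
    (p + q) * ((1 - p) + (1 - q)) = (p - q) * (p - q) := by
  simp only [mul_add, add_mul, mul_sub, sub_mul, mul_one, hp, hq]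
  abel

theorem sq_sub_mul_add_compl_mul_compl_add (hp : p * p = p) (hq : q * q = q) :
    (p - q) * (p - q) * (p + (1 - q)) * ((1 - p) + q) =
      -(((p + q - 1) * (p - q)) * ((p + q - 1) * (p - q))) := by
  have hp' : ∀ x, p * (p * x) = p * x := fun x => by rw [← mul_assoc, hp]
  have hq' : ∀ x, q * (q * x) = q * x := fun x => by rw [← mul_assoc, hq]
  simp only [mul_add, add_mul, mul_sub, sub_mul, mul_assoc, mul_one, one_mul, hp, hq, hp', hq']
  abel

/-- For self-adjoint `p`, `q`, `e` the left-hand side is `T T⋆` with `T = p q e`. -/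
theorem compression_mul_eq {e : R} (hq : q * q = q) (he : e * e = e) (hpe : Commute p e)
    (hqe : Commute q e) : p * q * e * (e * (q * p)) = p * q * p * e := by
  calc p * q * e * (e * (q * p)) = p * q * (e * e) * q * p := by simp only [mul_assoc]
    _ = p * q * (e * q) * p := by rw [he]; simp only [mul_assoc]
    _ = p * (q * q) * (e * p) := by rw [← hqe.eq]; simp only [mul_assoc]
    _ = p * q * p * e := by rw [hq, ← hpe.eq]; simp only [mul_assoc]

end Idempotents

variable {A H : Type*} [NonUnitalCStarAlgebra A] [PartialOrder A]
  [SMul A H] [NormedAddCommGroup H] [NormedSpace ℂ H] [CStarModule A H]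

/-! ### Adjoints -/

section Adjoints

variable {S T S' T' : H →L[ℂ] H}

theorem eq_zero_of_inner_self {x : H} (h : inner A x x = 0) : x = 0 :=
  CStarModule.inner_self.mp h

theorem IsAdjointOf.symm (h : IsAdjointOf A S T) : IsAdjointOf A T S := fun x y => by
  rw [← CStarModule.star_inner, ← h, CStarModule.star_inner]

theorem IsAdjointOf.unique (h : IsAdjointOf A S T) (h' : IsAdjointOf A S' T) : S = S' := by
  ext y
  rw [← sub_eq_zero]
  apply eq_zero_of_inner_self (A := A)
  rw [CStarModule.inner_sub_right, ← h, ← h', sub_self]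

theorem isAdjointOf_one : IsAdjointOf A (1 : H →L[ℂ] H) 1 := fun _ _ => rfl

theorem IsAdjointOf.add (h : IsAdjointOf A S T) (h' : IsAdjointOf A S' T') :
    IsAdjointOf A (S + S') (T + T') := fun x y => by
  simp [h x y, h' x y]

theorem IsAdjointOf.sub (h : IsAdjointOf A S T) (h' : IsAdjointOf A S' T') :
    IsAdjointOf A (S - S') (T - T') := fun x y => by
  simp [h x y, h' x y]

theorem IsAdjointOf.mul (h : IsAdjointOf A S T) (h' : IsAdjointOf A S' T') :
    IsAdjointOf A (S * S') (T' * T) := fun x y => by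
  simp only [mul_apply_eq_comp]
  rw [h', h]

variable {P : H →L[ℂ] H}

theorem IsProjection.compl (hP : IsProjection A P) : IsProjection A (1 - P) where
  mul_self := by
    have := hP.mul_self
    simp [mul_sub, sub_mul, this]
  selfAdjoint := isAdjointOf_one.sub hP.selfAdjoint

theorem IsProjection.rangeOf_eq (hP : IsProjection A P) : rangeOf P = nullOf (1 - P) := by
  ext x
  constructor
  · rintro ⟨y, rfl⟩
    change P y - P (P y) = 0
    rw [← mul_apply_eq_comp, hP.mul_self, sub_self]
  · intro hx
    have hx' : x - P x = 0 := hx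
    exact ⟨x, (sub_eq_zero.mp hx').symm⟩

theorem IsProjection.nullOf_eq (hP : IsProjection A P) : nullOf P = rangeOf (1 - P) := by
  rw [hP.compl.rangeOf_eq, sub_sub_cancel]

variable [StarOrderedRing A]

theorem IsAdjointOf.norm_apply_sq_le (h : IsAdjointOf A S T) (x : H) :
    ‖T x‖ ^ 2 ≤ ‖x‖ * ‖S (T x)‖ := by
  rw [CStarModule.norm_sq_eq A, h]
  exact CStarModule.norm_inner_le H

theorem IsAdjointOf.norm_le (h : IsAdjointOf A S T) : ‖T‖ ≤ ‖S‖ := by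
  refine T.opNorm_le_bound (norm_nonneg _) fun x => ?_
  rcases (norm_nonneg (T x)).eq_or_lt with h0 | h0
  · rw [← h0]; positivity
  · refine le_of_mul_le_mul_right ?_ h0
    calc ‖T x‖ * ‖T x‖ = ‖T x‖ ^ 2 := (sq _).symm
      _ ≤ ‖x‖ * ‖S (T x)‖ := h.norm_apply_sq_le x
      _ ≤ ‖x‖ * (‖S‖ * ‖T x‖) := by gcongr; exact S.le_opNorm _
      _ = ‖S‖ * ‖x‖ * ‖T x‖ := by ring

theorem IsAdjointOf.norm_eq (h : IsAdjointOf A S T) : ‖T‖ = ‖S‖ :=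
  le_antisymm h.norm_le h.symm.norm_le

/-- The nontrivial half of the C⋆-identity `‖T⋆ T‖ = ‖T‖²`. -/
theorem IsAdjointOf.norm_sq_le (h : IsAdjointOf A S T) : ‖T‖ ^ 2 ≤ ‖S * T‖ := by
  have hT : ‖T‖ ≤ √‖S * T‖ := by
    refine T.opNorm_le_bound (Real.sqrt_nonneg _) fun x => ?_
    refine abs_le_of_sq_le_sq' ?_ (by positivity) |>.2
    calc ‖T x‖ ^ 2 ≤ ‖x‖ * ‖(S * T) x‖ := h.norm_apply_sq_le x
      _ ≤ ‖x‖ * (‖S * T‖ * ‖x‖) := by gcongr; exact (S * T).le_opNorm _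
      _ = (√‖S * T‖ * ‖x‖) ^ 2 := by rw [mul_pow, Real.sq_sqrt (norm_nonneg _)]; ring
  calc ‖T‖ ^ 2 ≤ √‖S * T‖ ^ 2 := by gcongr
    _ = ‖S * T‖ := Real.sq_sqrt (norm_nonneg _)

theorem IsProjection.norm_le_one (hP : IsProjection A P) : ‖P‖ ≤ 1 := by
  have h := hP.selfAdjoint.norm_sq_le
  rw [hP.mul_self, sq] at h
  by_contra! hlt
  exact h.not_gt (lt_mul_of_one_lt_left (one_pos.trans hlt) hlt)

/-- If the orbit of `w` under a self-adjoint `b` grows at most like `C rⁿ`, then already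
`‖b w‖ ≤ r ‖w‖`, because the sequence `n ↦ ‖bⁿ w‖` is log-convex. -/
theorem IsAdjointOf.norm_apply_le_of_norm_pow_apply_le {b : H →L[ℂ] H} (hb : IsAdjointOf A b b)
    {w : H} {C r : ℝ} (hr : 0 ≤ r) (h : ∀ n : ℕ, ‖(b ^ n) w‖ ≤ C * r ^ n) :
    ‖b w‖ ≤ r * ‖w‖ := by
  rcases (norm_nonneg w).eq_or_lt with h0 | h0
  · have : w = 0 := norm_eq_zero.mp h0.symm
    simp [this]
  set t : ℝ := ‖b w‖ / ‖w‖ with ht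
  have ht0 : 0 ≤ t := by positivity
  have hstep : ∀ n : ℕ, t * ‖(b ^ n) w‖ ≤ ‖(b ^ (n + 1)) w‖ := by
    intro n
    induction n with
    | zero => simp [ht, h0.ne']
    | succ n ih =>
      have hconv : ‖(b ^ (n + 1)) w‖ ^ 2 ≤ ‖(b ^ n) w‖ * ‖(b ^ (n + 1 + 1)) w‖ := by
        have := hb.norm_apply_sq_le ((b ^ n) w)
        simpa only [← mul_apply_eq_comp, ← pow_succ'] using this
      rcases (norm_nonneg ((b ^ n) w)).eq_or_lt with hn | hn
      · have : ‖(b ^ (n + 1)) w‖ = 0 := by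
          rw [← hn, zero_mul] at hconv
          exact pow_eq_zero_iff two_ne_zero |>.mp (le_antisymm hconv (sq_nonneg _))
        rw [this, mul_zero]
        exact norm_nonneg _
      · refine le_of_mul_le_mul_left ?_ hn
        calc ‖(b ^ n) w‖ * (t * ‖(b ^ (n + 1)) w‖)
            = t * ‖(b ^ n) w‖ * ‖(b ^ (n + 1)) w‖ := by ring
          _ ≤ ‖(b ^ (n + 1)) w‖ * ‖(b ^ (n + 1)) w‖ := by gcongr
          _ = ‖(b ^ (n + 1)) w‖ ^ 2 := (sq _).symm
          _ ≤ _ := hconv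
  have hgeom : ∀ n : ℕ, t ^ n * ‖w‖ ≤ C * r ^ n := by
    intro n
    refine le_trans ?_ (h n)
    induction n with
    | zero => simp
    | succ n ih =>
      calc t ^ (n + 1) * ‖w‖ = t * (t ^ n * ‖w‖) := by ring
        _ ≤ t * ‖(b ^ n) w‖ := by gcongr
        _ ≤ _ := hstep n
  have htr : t ≤ r := by
    by_contra! hlt
    have htpos : 0 < t := hr.trans_lt hlt
    have hlim : Filter.Tendsto (fun n : ℕ => C * (r / t) ^ n) Filter.atTop (nhds (C * 0)) :=
      (tendsto_pow_atTop_nhds_zero_of_lt_one (by positivity) ((div_lt_one htpos).mpr hlt)).const_mul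
        C
    have hle : ‖w‖ ≤ C * 0 := by
      refine ge_of_tendsto' hlim fun n => ?_
      rw [div_pow, ← mul_div_assoc, le_div_iff₀ (by positivity), mul_comm]
      exact hgeom n
    rw [mul_zero] at hle
    exact hle.not_gt h0
  rwa [ht, div_le_iff₀ h0] at htr

end Adjoints

/-! ### Orthogonal complements -/

section Complements

variable [StarOrderedRing A] {M N : Submodule ℂ H}

theorem isAdjointOf_projectionOnto (hM : OrthogonallyComplemented A M) :
    IsAdjointOf A (projectionOnto hM) (projectionOnto hM) := fun x y => by
  change inner A (M.projection (orthogonal A M) hM x) y =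
    inner A x (M.projection (orthogonal A M) hM y)
  have h1 : inner A (x - M.projection (orthogonal A M) hM x)
      (M.projection (orthogonal A M) hM y) = 0 :=
    Submodule.sub_projection_mem hM x _ (Submodule.projection_apply_mem hM y)
  have h2 : inner A (M.projection (orthogonal A M) hM x)
      (y - M.projection (orthogonal A M) hM y) = 0 := by
    rw [← CStarModule.star_inner, Submodule.sub_projection_mem hM y _
      (Submodule.projection_apply_mem hM x), star_zero]
  rw [CStarModule.inner_sub_left, sub_eq_zero] at h1
  rw [CStarModule.inner_sub_right, sub_eq_zero] at h2
  rw [h1, h2]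

theorem projectionOnto_mem (hM : OrthogonallyComplemented A M) (x : H) :
    projectionOnto hM x ∈ M :=
  Submodule.projection_apply_mem hM x

theorem one_sub_projectionOnto_mem (hM : OrthogonallyComplemented A M) (x : H) :
    (1 - projectionOnto hM) x ∈ orthogonal A M :=
  Submodule.sub_projection_mem hM x

theorem isProjection_projectionOnto (hM : OrthogonallyComplemented A M) :
    IsProjection A (projectionOnto hM) where
  mul_self := by
    ext x
    exact Submodule.projection_apply_of_mem_left hM (projectionOnto_mem hM x)
  selfAdjoint := isAdjointOf_projectionOnto hM

theorem IsProjection.mul_projectionOnto {P : H →L[ℂ] H} (hP : IsProjection A P)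
    (hM : OrthogonallyComplemented A M) (hle : M ≤ rangeOf P) :
    P * projectionOnto hM = projectionOnto hM := by
  ext x
  obtain ⟨y, hy⟩ := hle (projectionOnto_mem hM x)
  have hy : P y = projectionOnto hM x := hy
  rw [mul_apply_eq_comp, ← hy, ← mul_apply_eq_comp, hP.mul_self]

theorem IsProjection.commute_one_sub_projectionOnto {P : H →L[ℂ] H} (hP : IsProjection A P)
    (hM : OrthogonallyComplemented A M) (hle : M ≤ rangeOf P) :
    Commute P (1 - projectionOnto hM) := by
  have hE := isAdjointOf_projectionOnto hM
  have h1 := hP.mul_projectionOnto hM hle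
  have h2 := hP.selfAdjoint.mul hE
  rw [h1] at h2
  refine (Commute.one_right P).sub_right ?_
  -- Taking adjoints in `P E = E` gives `E P = E`.
  exact h1.trans (hE.symm.unique h2.symm)

theorem orthogonal_orthogonal (hM : OrthogonallyComplemented A M) :
    orthogonal A (orthogonal A M) = M := by
  apply le_antisymm
  · intro x hx
    have hEx := projectionOnto_mem hM x
    have h1 := one_sub_projectionOnto_mem hM x
    have h2 : (1 - projectionOnto hM) x = 0 := by
      apply eq_zero_of_inner_self (A := A)
      have h3 : inner A x ((1 - projectionOnto hM) x) = 0 := hx _ h1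
      have h4 : inner A (projectionOnto hM x) ((1 - projectionOnto hM) x) = 0 := by
        rw [← CStarModule.star_inner, h1 _ hEx, star_zero]
      nth_rewrite 1 [sub_apply]
      rw [CStarModule.inner_sub_left, h4, sub_zero]
      exact h3
    have h5 : x = projectionOnto hM x := sub_eq_zero.mp h2
    rwa [h5]
  · intro x hx y hy
    rw [← CStarModule.star_inner, hy x hx, star_zero]

theorem OrthogonallyComplemented.orthogonal (hM : OrthogonallyComplemented A M) :
    OrthogonallyComplemented A (orthogonal A M) := by
  unfold OrthogonallyComplemented
  rw [orthogonal_orthogonal hM]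
  exact hM.symm

theorem orthogonal_closure_range {B : H →L[ℂ] H} (hB : IsAdjointOf A B B) :
    orthogonal A (rangeOf B).topologicalClosure = nullOf B := by
  ext x
  constructor
  · intro hx
    change B x = 0
    apply eq_zero_of_inner_self (A := A)
    rw [hB]
    exact hx _ (Submodule.le_topologicalClosure _ ⟨B x, rfl⟩)
  · intro hx y hy
    have hclosed : IsClosed {y : H | inner A x y = 0} :=
      isClosed_eq (CStarModule.continuous_inner.comp (by fun_prop : Continuous fun y => (x, y)))
        continuous_const
    refine closure_minimal ?_ hclosed hy
    rintro _ ⟨z, rfl⟩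
    have hx' : B x = 0 := hx
    change inner A x (B z) = 0
    rw [← hB, hx', CStarModule.inner_zero_left]

/-- If `H` splits along the closure of the range of the self-adjoint operator `B`, an operator takes
all its values in a closed subspace `V` as soon as it does so on `N(B)` and on `R(B)`. -/
theorem apply_mem_of_range_of_null {B T : H →L[ℂ] H} (hB : IsAdjointOf A B B)
    (hc : OrthogonallyComplemented A (rangeOf B).topologicalClosure) {V : Submodule ℂ H}
    (hV : IsClosed (V : Set H)) (h0 : ∀ x, B x = 0 → T x ∈ V) (h1 : ∀ x, T (B x) ∈ V) (x : H) :
    T x ∈ V := by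
  have hmem : ∀ y ∈ (rangeOf B).topologicalClosure, T y ∈ V := by
    intro y hy
    refine closure_minimal ?_ (hV.preimage T.continuous) hy
    rintro _ ⟨z, rfl⟩
    exact h1 z
  have hE := hmem _ (projectionOnto_mem hc x)
  have hE' := one_sub_projectionOnto_mem hc x
  rw [orthogonal_closure_range hB] at hE'
  have hsum := V.add_mem hE (h0 _ hE')
  rw [← map_add] at hsum
  simpa using hsum

end Complements

/-! ### Pairs of projections -/

section Pairs

variable {P Q : H →L[ℂ] H}

theorem Harmonious.compl (h : Harmonious A P Q) : Harmonious A (1 - P) (1 - Q) where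
  isProjection_left := h.isProjection_left.compl
  isProjection_right := h.isProjection_right.compl
  range_add := h.range_compl_add_compl
  range_add_compl := by rw [sub_sub_cancel]; exact h.range_compl_add
  range_compl_add := by rw [sub_sub_cancel]; exact h.range_add_compl
  range_compl_add_compl := by rw [sub_sub_cancel, sub_sub_cancel]; exact h.range_add

variable [StarOrderedRing A]

/-- If `(P + Q) x = 0`, then `⟨P x, P x⟩ + ⟨Q x, Q x⟩ = 0`, and both terms are positive. -/
theorem nullOf_add (hP : IsProjection A P) (hQ : IsProjection A Q) :
    nullOf (P + Q) = nullOf P ⊓ nullOf Q := by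
  ext x
  constructor
  · intro hx
    have hx' : P x + Q x = 0 := hx
    have hpos : ∀ {T : H →L[ℂ] H}, IsProjection A T →
        inner A x (T x) = inner A (T x) (T x) := fun {T} hT => by
      rw [hT.selfAdjoint x (T x), ← mul_apply_eq_comp, hT.mul_self]
    have hsum : inner A (P x) (P x) + inner A (Q x) (Q x) = 0 := by
      rw [← hpos hP, ← hpos hQ, ← CStarModule.inner_add_right, hx', CStarModule.inner_zero_right]
    obtain ⟨h1, h2⟩ := (add_eq_zero_iff_of_nonneg CStarModule.inner_self_nonneg
      CStarModule.inner_self_nonneg).mp hsum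
    exact ⟨eq_zero_of_inner_self h1, eq_zero_of_inner_self h2⟩
  · rintro ⟨h1, h2⟩
    have h1' : P x = 0 := h1
    have h2' : Q x = 0 := h2
    change P x + Q x = 0
    rw [h1', h2', add_zero]

theorem add_apply_eq_zero (hP : IsProjection A P) (hQ : IsProjection A Q) {x : H}
    (hx : (P + Q) x = 0) : P x = 0 ∧ Q x = 0 := by
  have : x ∈ nullOf P ⊓ nullOf Q := nullOf_add hP hQ ▸ hx
  exact this

theorem orthogonallyComplemented_null_inf_null (hP : IsProjection A P) (hQ : IsProjection A Q)
    (h : OrthogonallyComplemented A (rangeOf (P + Q)).topologicalClosure) :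
    OrthogonallyComplemented A (nullOf P ⊓ nullOf Q) := by
  have := OrthogonallyComplemented.orthogonal h
  rwa [orthogonal_closure_range (hP.selfAdjoint.add hQ.selfAdjoint), nullOf_add hP hQ] at this

theorem orthogonal_null_inf_null (hP : IsProjection A P) (hQ : IsProjection A Q)
    (h : OrthogonallyComplemented A (rangeOf (P + Q)).topologicalClosure) :
    orthogonal A (nullOf P ⊓ nullOf Q) = (rangeOf (P + Q)).topologicalClosure := by
  rw [← nullOf_add hP hQ, ← orthogonal_closure_range (hP.selfAdjoint.add hQ.selfAdjoint),
    orthogonal_orthogonal h]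

/-- A closed subspace contains `R(P + Q)` once it contains `R(P)`, `N(P) ∩ R(Q)` and the range of
`(P + Q - 1)(P - Q)`. -/
theorem Harmonious.add_apply_mem (h : Harmonious A P Q) {V : Submodule ℂ H}
    (hV : IsClosed (V : Set H)) (hVP : ∀ x, P x ∈ V) (hVQ : ∀ x, P x = 0 → Q x = x → x ∈ V)
    (hVZ : ∀ x, ((P + Q - 1) * (P - Q)) x ∈ V) (x : H) : (P + Q) x ∈ V := by
  have hP := h.isProjection_left
  have hQ := h.isProjection_right
  have hfix : ∀ {T : H →L[ℂ] H} {y : H}, (1 - T) y = 0 → T y = y :=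
    fun {T y} hy => (sub_eq_zero.mp hy).symm
  have hXY : ∀ y, ((P - Q) * (P - Q) * (P + (1 - Q)) * ((1 - P) + Q)) y ∈ V := fun y => by
    rw [sq_sub_mul_add_compl_mul_compl_add hP.mul_self hQ.mul_self]
    exact V.neg_mem (hVZ _)
  have hYY' : ∀ y, ((P - Q) * (P - Q) * (P + (1 - Q))) y ∈ V := by
    refine apply_mem_of_range_of_null (hP.compl.selfAdjoint.add hQ.selfAdjoint)
      h.range_compl_add hV (fun y hy => ?_) hXY
    obtain ⟨h1, h2⟩ := add_apply_eq_zero hP.compl hQ hy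
    have h1 := hfix h1
    -- Here `y ∈ R(P) ∩ N(Q)`, on which the operator acts as multiplication by `2`.
    have : ((P - Q) * (P - Q) * (P + (1 - Q))) y = P (y + y) := by simp [h1, h2]
    rw [this]
    exact hVP _
  have hYY : ∀ y, ((P - Q) * (P - Q)) y ∈ V := by
    refine apply_mem_of_range_of_null (hP.selfAdjoint.add hQ.compl.selfAdjoint)
      h.range_add_compl hV (fun y hy => ?_) hYY'
    obtain ⟨h1, h2⟩ := add_apply_eq_zero hP hQ.compl hy
    have h2 := hfix h2
    have : ((P - Q) * (P - Q)) y = y := by simp [h1, h2]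
    rw [this]
    exact hVQ y h1 h2
  refine apply_mem_of_range_of_null (hP.compl.selfAdjoint.add hQ.compl.selfAdjoint)
    h.range_compl_add_compl hV (fun y hy => ?_) (fun y => ?_) x
  · obtain ⟨h1, h2⟩ := add_apply_eq_zero hP.compl hQ.compl hy
    have h1 := hfix h1
    have h2 := hfix h2
    have : (P + Q) y = P (y + y) := by simp [h1, h2]
    rw [this]
    exact hVP _
  · rw [← mul_apply_eq_comp, add_mul_compl_add_compl hP.mul_self hQ.mul_self]
    exact hYY y

/-- The vectors whose orbit under `b` grows at most like a constant multiple of `rⁿ`. -/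
def growthSubspace (b : H →L[ℂ] H) (r : ℝ) : Submodule ℂ H where
  carrier := {w | ∃ C : ℝ, ∀ n : ℕ, ‖(b ^ n) w‖ ≤ C * r ^ n}
  add_mem' := by
    rintro v w ⟨C, hC⟩ ⟨D, hD⟩
    refine ⟨C + D, fun n => ?_⟩
    rw [map_add, add_mul]
    exact (norm_add_le _ _).trans (add_le_add (hC n) (hD n))
  zero_mem' := ⟨0, fun n => by simp⟩
  smul_mem' := by
    rintro c w ⟨C, hC⟩
    refine ⟨‖c‖ * C, fun n => ?_⟩
    rw [map_smul, norm_smul, mul_assoc]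
    exact mul_le_mul_of_nonneg_left (hC n) (norm_nonneg c)

theorem mem_growthSubspace_of_apply_eq_zero {b : H →L[ℂ] H} {r : ℝ} (hr : 0 ≤ r) {w : H}
    (hw : b w = 0) : w ∈ growthSubspace b r := by
  refine ⟨‖w‖, fun n => ?_⟩
  cases n with
  | zero => simp
  | succ n =>
    rw [pow_succ, mul_apply_eq_comp, hw, map_zero, norm_zero]
    positivity

theorem mem_growthSubspace_of_semiconjBy {z k b : H →L[ℂ] H} (h : SemiconjBy z k b) (v : H) :
    z v ∈ growthSubspace b ‖k‖ := by
  refine ⟨‖z‖ * ‖v‖, fun n => ?_⟩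
  have hk : ‖(k ^ n) v‖ ≤ ‖k‖ ^ n * ‖v‖ := by
    induction n generalizing v with
    | zero => simp
    | succ n ih =>
      rw [pow_succ, mul_apply_eq_comp]
      calc ‖(k ^ n) (k v)‖ ≤ ‖k‖ ^ n * ‖k v‖ := ih (k v)
        _ ≤ ‖k‖ ^ n * (‖k‖ * ‖v‖) := by gcongr; exact k.le_opNorm v
        _ = ‖k‖ ^ (n + 1) * ‖v‖ := by ring
  have hn : (b ^ n) (z v) = z ((k ^ n) v) := by
    rw [← mul_apply_eq_comp, ← (h.pow_right n).eq, mul_apply_eq_comp]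
  calc ‖(b ^ n) (z v)‖ ≤ ‖z‖ * ‖(k ^ n) v‖ := hn ▸ z.le_opNorm _
    _ ≤ ‖z‖ * (‖k‖ ^ n * ‖v‖) := by gcongr
    _ = ‖z‖ * ‖v‖ * ‖k‖ ^ n := by ring

theorem IsAdjointOf.norm_apply_le_of_mem_closure_growthSubspace {b : H →L[ℂ] H}
    (hb : IsAdjointOf A b b) {r : ℝ} (hr : 0 ≤ r) {w : H}
    (hw : w ∈ (growthSubspace b r).topologicalClosure) : ‖b w‖ ≤ r * ‖w‖ := by
  have hclosed : IsClosed {w : H | ‖b w‖ ≤ r * ‖w‖} :=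
    isClosed_le (by fun_prop) (by fun_prop)
  refine closure_minimal ?_ hclosed hw
  rintro v ⟨C, hC⟩
  exact hb.norm_apply_le_of_norm_pow_apply_le hr hC

/-- On the orthogonal complement of `N(P) ∩ N(Q)` the compression of `1 - Q` to `N(P)` is bounded by
the norm of the compression of `Q` to `R(P)` away from `R(P) ∩ R(Q)`. -/
theorem Harmonious.norm_compl_compression_apply_le (h : Harmonious A P Q)
    (hM : OrthogonallyComplemented A (rangeOf P ⊓ rangeOf Q)) {w : H}
    (hw : w ∈ (rangeOf (P + Q)).topologicalClosure) :
    ‖((1 - P) * (1 - Q) * (1 - P)) w‖ ≤ ‖P * Q * P * (1 - projectionOnto hM)‖ * ‖w‖ := by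
  have hP := h.isProjection_left
  have hQ := h.isProjection_right
  set b := (1 - P) * (1 - Q) * (1 - P) with hb_def
  set k := P * Q * P * (1 - projectionOnto hM) with hk_def
  have hb : IsAdjointOf A b b := by
    have := (hP.compl.selfAdjoint.mul hQ.compl.selfAdjoint).mul hP.compl.selfAdjoint
    rwa [← mul_assoc] at this
  have hPE := hP.mul_projectionOnto hM inf_le_left
  have hQE := hQ.mul_projectionOnto hM inf_le_right
  have hZ : SemiconjBy ((P + Q - 1) * (P - Q)) k b := by
    have h1 := (semiconjBy_compression hP.mul_self hQ.mul_self).eq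
    have hZE : (P + Q - 1) * (P - Q) * projectionOnto hM = 0 := by
      rw [mul_assoc, sub_mul P, hPE, hQE, sub_self, mul_zero]
    have hPQPE : P * Q * P * projectionOnto hM = projectionOnto hM := by
      rw [mul_assoc, hPE, mul_assoc, hQE, hPE]
    unfold SemiconjBy
    rw [hk_def, mul_sub (P * Q * P), mul_one, hPQPE, mul_sub _ (P * Q * P), hZE, sub_zero, h1]
  refine hb.norm_apply_le_of_mem_closure_growthSubspace (norm_nonneg k) ?_
  refine Submodule.topologicalClosure_minimal _ ?_ (Submodule.isClosed_topologicalClosure _) hw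
  rintro _ ⟨x, rfl⟩
  have hle := (growthSubspace b ‖k‖).le_topologicalClosure
  refine h.add_apply_mem (Submodule.isClosed_topologicalClosure _) (fun y => hle ?_)
    (fun y h1 h2 => hle ?_) (fun y => hle (mem_growthSubspace_of_semiconjBy hZ y)) x
  · refine mem_growthSubspace_of_apply_eq_zero (norm_nonneg k) ?_
    have hPy : (1 - P) (P y) = 0 := by
      change P y - P (P y) = 0
      rw [← mul_apply_eq_comp, hP.mul_self, sub_self]
    rw [hb_def, mul_apply_eq_comp, hPy, map_zero]
  · refine mem_growthSubspace_of_apply_eq_zero (norm_nonneg k) ?_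
    simp [hb_def, h1, h2]

/-- One of the two inequalities between the norms. Both norms satisfy `‖T‖² = ‖T T⋆‖`, which reduces
the claim to the compressions `P Q P` and `(1 - P)(1 - Q)(1 - P)`. -/
theorem Harmonious.norm_compl_mul_compl_le (h : Harmonious A P Q)
    (hM : OrthogonallyComplemented A (rangeOf P ⊓ rangeOf Q))
    (hN : OrthogonallyComplemented A (nullOf P ⊓ nullOf Q)) :
    ‖(1 - P) * (1 - Q) * (1 - projectionOnto hN)‖ ≤ ‖P * Q * (1 - projectionOnto hM)‖ := by
  have hP := h.isProjection_left
  have hQ := h.isProjection_right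
  have hE := (isProjection_projectionOnto hM).compl
  have hF := (isProjection_projectionOnto hN).compl
  have hk : ‖P * Q * P * (1 - projectionOnto hM)‖ ≤ ‖P * Q * (1 - projectionOnto hM)‖ ^ 2 := by
    rw [← compression_mul_eq hQ.mul_self hE.mul_self
      (hP.commute_one_sub_projectionOnto hM inf_le_left)
      (hQ.commute_one_sub_projectionOnto hM inf_le_right), sq]
    refine (norm_mul_le _ _).trans_eq ?_
    rw [((hP.selfAdjoint.mul hQ.selfAdjoint).mul hE.selfAdjoint).symm.norm_eq]
  have hb : ‖(1 - P) * (1 - Q) * (1 - P) * (1 - projectionOnto hN)‖ ≤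
      ‖P * Q * P * (1 - projectionOnto hM)‖ := by
    refine ContinuousLinearMap.opNorm_le_bound _ (norm_nonneg _) fun x => ?_
    have hmem := one_sub_projectionOnto_mem hN x
    rw [orthogonal_null_inf_null hP hQ h.range_add] at hmem
    refine (h.norm_compl_compression_apply_le hM hmem).trans ?_
    gcongr
    simpa using (1 - projectionOnto hN).le_of_opNorm_le hF.norm_le_one x
  have hT := (hP.compl.selfAdjoint.mul hQ.compl.selfAdjoint).mul hF.selfAdjoint
  rw [← hT.norm_eq]
  refine (pow_le_pow_iff_left₀ (norm_nonneg _) (norm_nonneg _) two_ne_zero).mp ?_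
  refine hT.norm_sq_le.trans (le_trans (le_of_eq ?_) (hb.trans hk))
  rw [compression_mul_eq hQ.compl.mul_self hF.mul_self
    (hP.compl.commute_one_sub_projectionOnto hN (inf_le_left.trans hP.nullOf_eq.le))
    (hQ.compl.commute_one_sub_projectionOnto hN (inf_le_right.trans hQ.nullOf_eq.le))]

end Pairs

end HilbertModule

theorem mainTheorem4 {A H : Type*} [NonUnitalCStarAlgebra A] [PartialOrder A] [StarOrderedRing A]
    [SMul A H] [NormedAddCommGroup H] [NormedSpace ℂ H] [CompleteSpace H] [CStarModule A H]
    (P Q : H →L[ℂ] H) (hPQ : HilbertModule.Harmonious A P Q) :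
    ∃ (hR : HilbertModule.OrthogonallyComplemented A
          (HilbertModule.rangeOf P ⊓ HilbertModule.rangeOf Q))
      (hN : HilbertModule.OrthogonallyComplemented A
          (HilbertModule.nullOf P ⊓ HilbertModule.nullOf Q)),
      ‖P * Q * (1 - HilbertModule.projectionOnto hR)‖ =
        ‖(1 - P) * (1 - Q) * (1 - HilbertModule.projectionOnto hN)‖ := by
  have hP := hPQ.isProjection_left
  have hQ := hPQ.isProjection_right
  have hR : HilbertModule.OrthogonallyComplemented A
      (HilbertModule.rangeOf P ⊓ HilbertModule.rangeOf Q) := by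
    rw [hP.rangeOf_eq, hQ.rangeOf_eq]
    exact HilbertModule.orthogonallyComplemented_null_inf_null hP.compl hQ.compl
      hPQ.range_compl_add_compl
  have hN := HilbertModule.orthogonallyComplemented_null_inf_null hP hQ hPQ.range_add
  refine ⟨hR, hN, le_antisymm ?_ (hPQ.norm_compl_mul_compl_le hR hN)⟩
  -- The first inequality for `1 - P`, `1 - Q`, with the two intersections left as variables so that
  -- they may be rewritten under `projectionOnto`.
  have key : ∀ {M N : Submodule ℂ H} (hM : HilbertModule.OrthogonallyComplemented A M)
      (hN : HilbertModule.OrthogonallyComplemented A N),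
      M = HilbertModule.rangeOf (1 - P) ⊓ HilbertModule.rangeOf (1 - Q) →
      N = HilbertModule.nullOf (1 - P) ⊓ HilbertModule.nullOf (1 - Q) →
      ‖(1 - (1 - P)) * (1 - (1 - Q)) * (1 - HilbertModule.projectionOnto hN)‖ ≤
        ‖(1 - P) * (1 - Q) * (1 - HilbertModule.projectionOnto hM)‖ := by
    rintro _ _ hM hN rfl rfl
    exact hPQ.compl.norm_compl_mul_compl_le hM hN
  have := key hN hR (by rw [hP.nullOf_eq, hQ.nullOf_eq]) (by rw [hP.rangeOf_eq, hQ.rangeOf_eq])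
  rwa [sub_sub_cancel, sub_sub_cancel] at this
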